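/- All graphs are finite, undirected and simple. A graph $H$ has a \emph{disconnected cut} if $V(H)$ can be partitioned into four nonempty sets $V_1,V_2,V_3,V_4$ such that there is no edge between $V_1$ and $V_3$ and no edge between $V_2$ and $V_4$. {\sc Disconnected Cut} asks whether a given connected graph has a disconnected cut. Write $L(G)$ for the line graph of $G$ and $\overline{G}$ for the complement of $G$. The diameter of a graph is the maximum distance between two of its vertices (it is $\infty$ if the graph is disconnected). A vertex has a \emph{disconnected neighbourhood} if its set of neighbours induces a disconnected graph. A graph is $2P_2$-\emph{free} if it has no induced subgraph isomorphic to the disjoint union of two single edges. Two distinct vertices $u,v$ of a graph form a \emph{universal pair} if every other vertex is adjacent to $u$ or to $v$, and there are distinct vertices $x,y\notin\{u,v\}$ such that $x$ is adjacent to $u$ and $y$ is adjacent to $v$. \textbf{Theorem.} (a) {\sc Disconnected Cut} is $O(n^4)$-time solvable on line graphs of $n$-vertex graphs. That is, there are a word-RAM program and constants $C,k$ such that for every $n$, every graph $G$ on the vertices $0,\dots,n-1$ whose line graph is connected, and every word length $w$ with $2^w\ge n^k$, the program, given $n$ and the adjacency matrix of $G$, stops after at most $C n^4$ steps and answers correctly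 whether $L(G)$ has a disconnected cut. (b) Let $G$ be a graph such that $L(G)$ has diameter $2$. Then: (i) $G$ is $2P_2$-free, and if $G$ has no isolated vertices, then $G$ has diameter at most $3$. (ii) If $G$ has diameter $2$, then $L(G)$ has a disconnected cut if and only if $\overline{G}$ has a universal pair. (iii) If no vertex of $L(G)$ has a disconnected neighbourhood and $G$ has diameter $1$ or $3$, then $L(G)$ has no disconnected cut. -/

import Mathlib

namespace SimpleGraph

variable {V : Type*}

/-- Two vertex sets are anticomplete if no edge joins a vertex of `S` to a vertex of `T`. -/
def Anticomplete (G : SimpleGraph V) (S T : Set V) : Prop :=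
  ∀ u ∈ S, ∀ v ∈ T, ¬ G.Adj u v

/-- `V₁, V₂, V₃, V₄` is a partition of the vertex set into four nonempty sets such that `V₁` is
anticomplete to `V₃` and `V₂` is anticomplete to `V₄`. -/
structure IsDisconnectedPartition (G : SimpleGraph V) (V₁ V₂ V₃ V₄ : Set V) : Prop where
  nonempty₁ : V₁.Nonempty
  nonempty₂ : V₂.Nonempty
  nonempty₃ : V₃.Nonempty
  nonempty₄ : V₄.Nonempty
  disjoint₁₂ : Disjoint V₁ V₂
  disjoint₁₃ : Disjoint V₁ V₃
  disjoint₁₄ : Disjoint V₁ V₄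
  disjoint₂₃ : Disjoint V₂ V₃
  disjoint₂₄ : Disjoint V₂ V₄
  disjoint₃₄ : Disjoint V₃ V₄
  cover : V₁ ∪ V₂ ∪ V₃ ∪ V₄ = Set.univ
  anticomplete₁₃ : G.Anticomplete V₁ V₃
  anticomplete₂₄ : G.Anticomplete V₂ V₄

/-- `G` has a disconnected cut: its vertex set has a disconnected partition `V₁, V₂, V₃, V₄`.
Equivalently, some vertex set (namely `V₁ ∪ V₃`) and its complement (namely `V₂ ∪ V₄`)
both induce disconnected subgraphs. -/
def HasDisconnectedCut (G : SimpleGraph V) : Prop :=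
  ∃ V₁ V₂ V₃ V₄ : Set V, G.IsDisconnectedPartition V₁ V₂ V₃ V₄

/-- The neighbourhood of `u` induces a disconnected graph, that is, there are two neighbours of
`u` that no path inside the neighbourhood joins. -/
def HasDisconnectedNeighborhood (G : SimpleGraph V) (u : V) : Prop :=
  ¬ (G.induce (G.neighborSet u)).Preconnected

/-- `G` is `2P₂`-free: it has no induced subgraph isomorphic to the disjoint union of two
paths on two vertices. -/
def IsTwoPTwoFree (G : SimpleGraph V) : Prop :=
  ¬ (pathGraph 2 ⊕g pathGraph 2) ⊴ G

/-- Every vertex outside `D` has a neighbour in `D`. -/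
def IsDominatingSet (G : SimpleGraph V) (D : Set V) : Prop :=
  ∀ w ∉ D, ∃ d ∈ D, G.Adj w d

/-- `u, v` is a universal pair of `G`. -/
def IsUniversalPair (G : SimpleGraph V) (u v : V) : Prop :=
  u ≠ v ∧ G.IsDominatingSet {u, v} ∧
    ∃ x y : V, x ≠ y ∧ x ∉ ({u, v} : Set V) ∧ y ∉ ({u, v} : Set V) ∧ G.Adj u x ∧ G.Adj v y

end SimpleGraph

namespace WordRAM

/-- Instructions of a unit-cost word RAM. The arguments `d`, `a`, `b` are register numbers, `c` is
a constant and `l` is a line number of the program. -/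
inductive Instr where
  /-- register `d` := `c` -/
  | const (d c : ℕ)
  /-- register `d` := register `a` + register `b` -/
  | add (d a b : ℕ)
  /-- register `d` := register `a` - register `b` (and `0` if this is negative) -/
  | sub (d a b : ℕ)
  /-- register `d` := register `a` * register `b` -/
  | mul (d a b : ℕ)
  /-- register `d` := the memory cell whose address is in register `a` -/
  | load (d a : ℕ)
  /-- the memory cell whose address is in register `a` := register `b` -/
  | store (a b : ℕ)
  /-- go to line `l` if register `a` is smaller than register `b` -/
  | jumpLt (a b l : ℕ)
  /-- stop with the given answer -/
  | halt (answer : Bool)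

/-- A program is a finite list of instructions; lines are numbered from `0`. -/
abbrev Program := List Instr

/-- A configuration: either the machine is about to execute line `pc`, with the given contents of
the registers and of the memory, or it has stopped with an answer. -/
inductive Config where
  | running (pc : ℕ) (reg mem : ℕ → ℕ)
  | halted (answer : Bool)

/-- The effect of an instruction for words of `w` bits: results of arithmetic are reduced
modulo `2 ^ w`. -/
def exec (w pc : ℕ) (reg mem : ℕ → ℕ) : Instr → Config
  | .const d c => .running (pc + 1) (Function.update reg d (c % 2 ^ w)) mem
  | .add d a b => .running (pc + 1) (Function.update reg d ((reg a + reg b) % 2 ^ w)) mem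
  | .sub d a b => .running (pc + 1) (Function.update reg d ((reg a - reg b) % 2 ^ w)) mem
  | .mul d a b => .running (pc + 1) (Function.update reg d ((reg a * reg b) % 2 ^ w)) mem
  | .load d a => .running (pc + 1) (Function.update reg d (mem (reg a))) mem
  | .store a b => .running (pc + 1) reg (Function.update mem (reg a) (reg b))
  | .jumpLt a b l => .running (if reg a < reg b then l else pc + 1) reg mem
  | .halt answer => .halted answer

/-- One step of the program `P` with `w`-bit words. A configuration that has stopped does not
change, and a machine that leaves its program stays where it is and never stops. -/
def step (P : Program) (w : ℕ) : Config → Config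
  | .halted answer => .halted answer
  | .running pc reg mem =>
    match P[pc]? with
    | some i => exec w pc reg mem i
    | none => .running pc reg mem

/-- The program `P`, with `w`-bit words, started in the configuration `c`, stops after at most
`t` steps with the given answer. -/
def HaltsWithin (P : Program) (w : ℕ) (c : Config) (t : ℕ) (answer : Bool) : Prop :=
  (step P w)^[t] c = .halted answer

open Classical in
/-- The initial configuration on a graph with vertices `0, …, n - 1`: register `0` contains `n`,
the memory cells `0, …, n * n - 1` contain the adjacency matrix of the graph row by row, and all
other registers and memory cells contain `0`. -/
noncomputable def input {n : ℕ} (G : SimpleGraph (Fin n)) : Config :=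
  .running 0 (fun r => if r = 0 then n else 0)
    (fun a => if ∃ i j : Fin n, a = (i : ℕ) * n + (j : ℕ) ∧ G.Adj i j then 1 else 0)

end WordRAM

/-! Two edges of G are at distance at most 2 in L(G) exactly when they share a vertex or are joined
by an edge (`EdgesJoined` asks this of all pairs). If some pair fails this and L(G) is connected,
the distance levels around one of the two edges give a disconnected cut.

If all pairs are joined, a disconnected cut exists iff G has a cutting edge uv. Given uv, sort the
edges by which of u and v they contain. Conversely, a cut V₁, ..., V₄ labels each vertex by p (it
touches V₁) and q (it touches V₂). No edge changes both labels, so the classes A = p∧q, B = p∧¬q, D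
= ¬p∧¬q, C = ¬p∧q form a cycle A, B, D, C, and joinedness then forces a cutting edge
(`EdgesJoined.exists_isCuttingEdge`).

For (b), a cutting edge has a disconnected neighbourhood in L(G), and in diameter at most 2 cutting
edges are the universal pairs of the complement. For (a), both criteria are first-order sentences of
quantifier depth 4, which nested loops evaluate in time O(n⁴) (`haltsWithin_code`). -/

namespace SimpleGraph

/-! ### Disconnected cuts of line graphs and cutting edges. -/

section DisconnectedCut

variable {V : Type*} {G : SimpleGraph V}

/-- Any two edges of `G` share a vertex or are joined by an edge. -/
def EdgesJoined (G : SimpleGraph V) : Prop :=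
  ∀ a b c d, G.Adj a b → G.Adj c d → G.Adj a c ∨ G.Adj a d ∨ G.Adj b c ∨ G.Adj b d

/-- `uv` is an edge in no triangle, both ends of which have another neighbour, and some edge
is disjoint from it. -/
def IsCuttingEdge (G : SimpleGraph V) (u v : V) : Prop :=
  G.Adj u v ∧ (∀ x, ¬ (G.Adj u x ∧ G.Adj v x)) ∧ (∃ x, G.Adj v x ∧ u ≠ x) ∧
    (∃ y, G.Adj u y ∧ v ≠ y) ∧ ∃ z w, G.Adj z w ∧ u ≠ z ∧ v ≠ z ∧ u ≠ w ∧ v ≠ w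

/-- If the edge within `p` stays on one side of `q`, join it to an edge on the other side. Somewhere
on the way `q` changes, and the edge where it does cannot change `p` as well. -/
lemma EdgesJoined.exists_adj_crossing (hG : G.EdgesJoined) {p q : V → Prop}
    (hpq : ∀ u v, G.Adj u v → (p u ↔ p v) ∨ (q u ↔ q v))
    (hp : ∃ u v, G.Adj u v ∧ p u ∧ p v) (hq : ∃ u v, G.Adj u v ∧ q u ∧ q v)
    (hq' : ∃ u v, G.Adj u v ∧ ¬ q u ∧ ¬ q v) :
    ∃ u v, G.Adj u v ∧ p u ∧ p v ∧ q u ∧ ¬ q v := by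
  obtain ⟨a, b, hab, ha, hb⟩ := hp
  obtain ⟨c, d, hcd, hc, hd⟩ := hq
  obtain ⟨c', d', hcd', hc', hd'⟩ := hq'
  have key : ∀ x y, G.Adj x y → p x → ¬ (q x ↔ q y) →
      ∃ u v, G.Adj u v ∧ p u ∧ p v ∧ q u ∧ ¬ q v := by
    intro x y hxy hx hne
    have hy : p y := by have := hpq x y hxy; tauto
    by_cases hqx : q x
    · exact ⟨x, y, hxy, hx, hy, hqx, by tauto⟩
    · exact ⟨y, x, hxy.symm, hy, hx, by tauto, hqx⟩
  by_cases hqa : q a <;> by_cases hqb : q b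
  · rcases hG a b c' d' hab hcd' with h | h | h | h
    exacts [key _ _ h ha (by tauto), key _ _ h ha (by tauto), key _ _ h hb (by tauto),
      key _ _ h hb (by tauto)]
  · exact key a b hab ha (by tauto)
  · exact key a b hab ha (by tauto)
  · rcases hG a b c d hab hcd with h | h | h | h
    exacts [key _ _ h ha (by tauto), key _ _ h ha (by tauto), key _ _ h hb (by tauto),
      key _ _ h hb (by tauto)]

/-- An edge inside A excludes one inside D, since no edge runs between A and D. So the BD edge and
the CD edge yield a common neighbour `e` in D of `b` and `c`. As B and C cannot both contain an
edge, `be` or `ce` lies in no triangle. -/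
lemma EdgesJoined.exists_isCuttingEdge_of_adj_within (hG : G.EdgesJoined) {p q : V → Prop}
    (hpq : ∀ u v, G.Adj u v → (p u ↔ p v) ∨ (q u ↔ q v))
    (hA : ∃ u v, G.Adj u v ∧ p u ∧ p v ∧ q u ∧ q v)
    (hBD : ∃ u v, G.Adj u v ∧ ¬ q u ∧ ¬ q v ∧ p u ∧ ¬ p v)
    (hCD : ∃ u v, G.Adj u v ∧ ¬ p u ∧ ¬ p v ∧ q u ∧ ¬ q v) :
    ∃ u v, G.IsCuttingEdge u v := by
  obtain ⟨a, x, hax, hpa, hpx, hqa, hqx⟩ := hA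
  obtain ⟨b, d, hbd, hqb, hqd, hpb, hpd⟩ := hBD
  obtain ⟨c, d', hcd, hpc, hpd', hqc, hqd'⟩ := hCD
  have hD : ∀ y z, G.Adj y z → ¬ p y → ¬ q y → ¬ p z → ¬ q z → False := by
    intro y z hyz h1 h2 h3 h4
    rcases hG a x y z hax hyz with h | h | h | h <;> · have := hpq _ _ h; tauto
  obtain ⟨e, hbe, hce, hpe, hqe⟩ : ∃ e, G.Adj b e ∧ G.Adj c e ∧ ¬ p e ∧ ¬ q e := by
    rcases hG b d c d' hbd hcd with h | h | h | h
    · have := hpq _ _ h; tauto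
    · exact ⟨d', h, hcd, hpd', hqd'⟩
    · exact ⟨d, hbd, h.symm, hpd, hqd⟩
    · exact (hD _ _ h hpd hqd hpd' hqd').elim
  -- The edge `ye` is joined to the edge `ax` inside A, and `e` has no neighbour in A.
  have nbr : ∀ y, G.Adj y e → ∃ z, G.Adj y z ∧ e ≠ z := by
    intro y hy
    rcases hG a x y e hax hy with h | h | h | h
    · exact ⟨a, h.symm, by rintro rfl; tauto⟩
    · have := hpq _ _ h; tauto
    · exact ⟨x, h.symm, by rintro rfl; tauto⟩
    · have := hpq _ _ h; tauto
  have cut : ∀ y z, G.Adj y e → G.Adj z e → y ≠ z → (¬ (p y ∧ q y)) →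
      (∀ t, G.Adj y t → G.Adj e t → False) → G.IsCuttingEdge y e := by
    refine fun y z hy hz hyz hyA ht ↦ ⟨hy, fun t h ↦ ht t h.1 h.2, ⟨z, hz.symm, hyz⟩, nbr y hy,
      a, x, hax, ?_, ?_, ?_, ?_⟩ <;> rintro rfl <;> tauto
  by_cases hB : ∃ y z, G.Adj y z ∧ p y ∧ p z ∧ ¬ q y ∧ ¬ q z
  -- A triangle on `ce` would have its third vertex in C, giving an edge inside C that cannot be
  -- joined to the one inside B.
  · refine ⟨c, e, cut c b hce hbe (by rintro rfl; tauto) (by tauto) fun t hct het ↦ ?_⟩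
    obtain ⟨y, z, hyz, hB⟩ := hB
    have h1 := hpq _ _ hct
    have h2 := hpq _ _ het
    have h3 := hD _ _ het hpe hqe
    have h4 := hG y z c t hyz hct
    have h5 := hpq y c
    have h6 := hpq y t
    have h7 := hpq z c
    have h8 := hpq z t
    grind
  -- A triangle on `be` would have its third vertex in B, but B contains no edge.
  · refine ⟨b, e, cut b c hbe hce (by rintro rfl; tauto) (by tauto) fun t hbt het ↦ hB ?_⟩
    have h1 := hpq _ _ hbt
    have h2 := hpq _ _ het
    have h3 := hD _ _ het hpe hqe
    exact ⟨b, t, hbt, by grind⟩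

/-- Without edges inside classes, the classes map G to a 4-cycle, so G has no triangle. -/
lemma isCuttingEdge_of_forall_not_adj_within {p q : V → Prop}
    (hpq : ∀ u v, G.Adj u v → (p u ↔ p v) ∨ (q u ↔ q v))
    (hind : ∀ u v, G.Adj u v → ¬ ((p u ↔ p v) ∧ (q u ↔ q v)))
    {a b : V} (hab : G.Adj a b) (hpab : p a ↔ p b)
    (hb : ∃ x, G.Adj b x ∧ ¬ (p b ↔ p x)) (ha : ∃ y, G.Adj a y ∧ ¬ (p a ↔ p y))
    (h : ∃ z w, G.Adj z w ∧ ¬ (p a ↔ p z) ∧ ¬ (p a ↔ p w)) :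
    G.IsCuttingEdge a b := by
  obtain ⟨x, hbx, hx⟩ := hb
  obtain ⟨y, hay, hy⟩ := ha
  obtain ⟨z, w, hzw, hz, hw⟩ := h
  refine ⟨hab, fun t ⟨hat, hbt⟩ ↦ ?_, ⟨x, hbx, by rintro rfl; tauto⟩,
    ⟨y, hay, by rintro rfl; tauto⟩, z, w, hzw, ?_, ?_, ?_, ?_⟩
  · have := hpq _ _ hat
    have := hpq _ _ hbt
    have := hind _ _ hat
    have := hind _ _ hbt
    have := hind _ _ hab
    grind
  all_goals rintro rfl; tauto

/-- If no edge lies inside a class, an edge joining an AC edge to a BD edge is cutting. Otherwise,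
complementing `p` or `q` moves the edge inside a class to A. -/
theorem EdgesJoined.exists_isCuttingEdge (hG : G.EdgesJoined) {p q : V → Prop}
    (hpq : ∀ u v, G.Adj u v → (p u ↔ p v) ∨ (q u ↔ q v))
    (hp : ∃ u v, G.Adj u v ∧ p u ∧ p v) (hp' : ∃ u v, G.Adj u v ∧ ¬ p u ∧ ¬ p v)
    (hq : ∃ u v, G.Adj u v ∧ q u ∧ q v) (hq' : ∃ u v, G.Adj u v ∧ ¬ q u ∧ ¬ q v) :
    ∃ u v, G.IsCuttingEdge u v := by
  have hqp : ∀ u v, G.Adj u v → (q u ↔ q v) ∨ (p u ↔ p v) := fun u v h ↦ (hpq u v h).symm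
  have flip : ∀ {r s : V → Prop}, (∃ u v, G.Adj u v ∧ r u ∧ r v ∧ s u ∧ ¬ s v) →
      ∃ u v, G.Adj u v ∧ r u ∧ r v ∧ ¬ s u ∧ ¬¬ s v :=
    fun ⟨u, v, h, h1, h2, h3, h4⟩ ↦ ⟨v, u, h.symm, h2, h1, h4, not_not.2 h3⟩
  have hpq₁ : ∀ u v, G.Adj u v → (¬ p u ↔ ¬ p v) ∨ (q u ↔ q v) := by
    simpa only [not_iff_not] using hpq
  have hpq₂ : ∀ u v, G.Adj u v → (p u ↔ p v) ∨ (¬ q u ↔ ¬ q v) := by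
    simpa only [not_iff_not] using hpq
  have hpq₃ : ∀ u v, G.Adj u v → (¬ p u ↔ ¬ p v) ∨ (¬ q u ↔ ¬ q v) := by
    simpa only [not_iff_not] using hpq
  have hqp₁ : ∀ u v, G.Adj u v → (¬ q u ↔ ¬ q v) ∨ (p u ↔ p v) := fun u v h ↦ (hpq₂ u v h).symm
  have hAB := hG.exists_adj_crossing hpq hp hq hq'
  have hCD := hG.exists_adj_crossing hpq₁ hp' hq hq'
  have hAC := hG.exists_adj_crossing hqp hq hp hp'
  have hBD := hG.exists_adj_crossing hqp₁ hq' hp hp'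
  by_cases hind : ∀ u v, G.Adj u v → ¬ ((p u ↔ p v) ∧ (q u ↔ q v))
  · obtain ⟨a, c, hac, hqa, hqc, hpa, hpc⟩ := hAC
    obtain ⟨b, d, hbd, hqb, hqd, hpb, hpd⟩ := hBD
    rcases hG a c b d hac hbd with h | h | h | h
    · obtain ⟨z, w, hzw, hz, hw, -⟩ := hCD
      exact ⟨a, b, isCuttingEdge_of_forall_not_adj_within hpq hind h (by tauto)
        ⟨d, hbd, by tauto⟩ ⟨c, hac, by tauto⟩ ⟨z, w, hzw, by tauto, by tauto⟩⟩
    · have := hpq _ _ h; tauto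
    · have := hpq _ _ h; tauto
    · obtain ⟨z, w, hzw, hz, hw, -⟩ := hAB
      exact ⟨c, d, isCuttingEdge_of_forall_not_adj_within hpq hind h (by tauto)
        ⟨b, hbd.symm, by tauto⟩ ⟨a, hac.symm, by tauto⟩ ⟨z, w, hzw, by tauto, by tauto⟩⟩
  · push Not at hind
    obtain ⟨u, v, huv, hpuv, hquv⟩ := hind
    by_cases hpu : p u <;> by_cases hqu : q u
    · exact hG.exists_isCuttingEdge_of_adj_within hpq
        ⟨u, v, huv, hpu, hpuv.1 hpu, hqu, hquv.1 hqu⟩ hBD hCD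
    · refine hG.exists_isCuttingEdge_of_adj_within hpq₂
        ⟨u, v, huv, hpu, by tauto, hqu, by tauto⟩ ?_ (flip hCD)
      simpa only [not_not] using hAC
    · refine hG.exists_isCuttingEdge_of_adj_within hpq₁
        ⟨u, v, huv, hpu, by tauto, hqu, by tauto⟩ (flip hBD) ?_
      simpa only [not_not] using hAB
    · refine hG.exists_isCuttingEdge_of_adj_within hpq₃
        ⟨u, v, huv, hpu, by tauto, hqu, by tauto⟩ ?_ ?_
      · simpa only [not_not] using flip hAC
      · simpa only [not_not] using flip hAB

/-- Edges in anticomplete parts share no vertex, so touching `V₁` is constant along edges of `V₁`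
and `V₃`, and touching `V₂` along those of `V₂` and `V₄`. -/
theorem EdgesJoined.exists_isCuttingEdge_of_hasDisconnectedCut (hG : G.EdgesJoined)
    (h : G.lineGraph.HasDisconnectedCut) : ∃ u v, G.IsCuttingEdge u v := by
  obtain ⟨V₁, V₂, V₃, V₄, h⟩ := h
  have sep : ∀ {S T : Set G.edgeSet}, Disjoint S T → G.lineGraph.Anticomplete S T →
      ∀ e ∈ S, ∀ f ∈ T, ∀ x, x ∈ e.1 → x ∉ f.1 := fun hd ha e he f hf x hxe hxf ↦
    ha e he f hf (lineGraph_adj_iff_exists.2 ⟨hd.ne_of_mem he hf, x, hxe, hxf⟩)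
  have sep₁₃ := sep h.disjoint₁₃ h.anticomplete₁₃
  have sep₂₄ := sep h.disjoint₂₄ h.anticomplete₂₄
  have touch : ∀ {S : Set G.edgeSet} {r : V → Prop}, S.Nonempty → (∀ e ∈ S, ∀ x ∈ e.1, r x) →
      ∃ u v, G.Adj u v ∧ r u ∧ r v := by
    rintro S r ⟨⟨⟨u, v⟩, huv⟩, he⟩ hr
    exact ⟨u, v, huv, hr _ he u (Sym2.mem_mk_left u v), hr _ he v (Sym2.mem_mk_right u v)⟩
  have h₁ : ∀ e ∈ V₁, ∀ x ∈ e.1, ∃ e ∈ V₁, x ∈ e.1 := fun e he x hx ↦ ⟨e, he, hx⟩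
  have h₂ : ∀ e ∈ V₂, ∀ x ∈ e.1, ∃ e ∈ V₂, x ∈ e.1 := fun e he x hx ↦ ⟨e, he, hx⟩
  have h₃ : ∀ e ∈ V₃, ∀ x ∈ e.1, ¬ ∃ e ∈ V₁, x ∈ e.1 :=
    fun e he x hx ⟨f, hf, hxf⟩ ↦ sep₁₃ f hf e he x hxf hx
  have h₄ : ∀ e ∈ V₄, ∀ x ∈ e.1, ¬ ∃ e ∈ V₂, x ∈ e.1 :=
    fun e he x hx ⟨f, hf, hxf⟩ ↦ sep₂₄ f hf e he x hxf hx
  refine hG.exists_isCuttingEdge (p := fun x ↦ ∃ e ∈ V₁, x ∈ e.1)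
    (q := fun x ↦ ∃ e ∈ V₂, x ∈ e.1) (fun u v huv ↦ ?_)
    (touch h.nonempty₁ h₁) (touch h.nonempty₃ h₃) (touch h.nonempty₂ h₂) (touch h.nonempty₄ h₄)
  have hu := Sym2.mem_mk_left u v
  have hv := Sym2.mem_mk_right u v
  have hmem : (⟨s(u, v), huv⟩ : G.edgeSet) ∈ V₁ ∪ V₂ ∪ V₃ ∪ V₄ := h.cover ▸ Set.mem_univ _
  rcases hmem with ((he | he) | he) | he
  · exact .inl (iff_of_true (h₁ _ he u hu) (h₁ _ he v hv))
  · exact .inr (iff_of_true (h₂ _ he u hu) (h₂ _ he v hv))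
  · exact .inl (iff_of_false (h₃ _ he u hu) (h₃ _ he v hv))
  · exact .inr (iff_of_false (h₄ _ he u hu) (h₄ _ he v hv))

/-- Adjacent edges of which one contains only `u` and the other only `v` would close a triangle on
`uv`. The only edge containing both is `uv`, which meets no edge avoiding both. -/
theorem IsCuttingEdge.hasDisconnectedCut {u v : V} (h : G.IsCuttingEdge u v) :
    G.lineGraph.HasDisconnectedCut := by
  obtain ⟨huv, htri, ⟨x, hvx, hux⟩, ⟨y, huy, hvy⟩, z, w, hzw, huz, hvz, huw, hvw⟩ := h
  refine ⟨{e | u ∈ e.1 ∧ v ∉ e.1}, {e | u ∈ e.1 ∧ v ∈ e.1}, {e | u ∉ e.1 ∧ v ∈ e.1},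
    {e | u ∉ e.1 ∧ v ∉ e.1}, ⟨⟨s(u, y), huy⟩, ?_⟩, ⟨⟨s(u, v), huv⟩, ?_⟩, ⟨⟨s(v, x), hvx⟩, ?_⟩,
    ⟨⟨s(z, w), hzw⟩, ?_⟩, ?_, ?_, ?_, ?_, ?_, ?_, ?_, ?_, ?_⟩
  · simp [hvy, huv.ne']
  · simp
  · simp [hux, huv.ne]
  · simp [huz, hvz, huw, hvw]
  iterate 6 rw [Set.disjoint_left]; rintro e ⟨h1, h2⟩ ⟨h3, h4⟩; tauto
  · ext e; simp only [Set.mem_union, Set.mem_ofPred_eq, Set.mem_univ]; tauto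
  · rintro ⟨e, he⟩ ⟨hue, hve⟩ ⟨f, hf⟩ ⟨huf, hvf⟩ hef
    obtain ⟨-, t, hte, htf⟩ := lineGraph_adj_iff_exists.1 hef
    obtain ⟨s, rfl⟩ := Sym2.mem_iff_exists.1 hue
    obtain ⟨s', rfl⟩ := Sym2.mem_iff_exists.1 hvf
    simp only [Sym2.mem_iff] at *
    have hus : G.Adj u s := he
    have hvs : G.Adj v s' := hf
    grind
  · rintro ⟨e, he⟩ ⟨hue, hve⟩ ⟨f, hf⟩ ⟨huf, hvf⟩ hef
    obtain ⟨-, t, hte, htf⟩ := lineGraph_adj_iff_exists.1 hef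
    obtain rfl := (Sym2.mem_and_mem_iff huv.ne).1 ⟨hue, hve⟩
    rcases Sym2.mem_iff.1 hte with rfl | rfl
    exacts [huf htf, hvf htf]

/-- The neighbours of `uv` are the other edges at `u` or at `v`. Passing from the first kind to the
second would need a triangle, so a path from `uy` never reaches `vx`. -/
theorem IsCuttingEdge.hasDisconnectedNeighborhood {u v : V} (h : G.IsCuttingEdge u v) :
    G.lineGraph.HasDisconnectedNeighborhood ⟨s(u, v), h.1⟩ := by
  obtain ⟨huv, htri, ⟨x, hvx, hux⟩, ⟨y, huy, hvy⟩, -⟩ := h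
  intro hconn
  have hy : (⟨s(u, y), huy⟩ : G.edgeSet) ∈ G.lineGraph.neighborSet ⟨s(u, v), huv⟩ := by
    rw [mem_neighborSet, lineGraph_adj_iff_exists]
    refine ⟨fun h ↦ hvy (Sym2.congr_right.1 (congrArg Subtype.val h)), u, by simp, by simp⟩
  have hx : (⟨s(v, x), hvx⟩ : G.edgeSet) ∈ G.lineGraph.neighborSet ⟨s(u, v), huv⟩ := by
    rw [mem_neighborSet, lineGraph_adj_iff_exists]
    refine ⟨fun h ↦ hux ?_, v, by simp, by simp⟩
    exact Sym2.congr_right.1 (Sym2.eq_swap.trans (congrArg Subtype.val h))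
  have hreach := (reachable_iff_reflTransGen _ _).1 (hconn ⟨_, hy⟩ ⟨_, hx⟩)
  have key : ∀ e, Relation.ReflTransGen
      (G.lineGraph.induce (G.lineGraph.neighborSet ⟨s(u, v), huv⟩)).Adj ⟨_, hy⟩ e →
      u ∈ e.1.1 := by
    intro e he
    induction he with
    | refl => simp
    | @tail g f _ hef ih =>
      obtain ⟨⟨g, hg⟩, hne'⟩ := g
      obtain ⟨⟨f, hf⟩, hnf'⟩ := f
      have hnf := hnf'
      have hne := hne'
      rw [mem_neighborSet, lineGraph_adj_iff_exists] at hne hnf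
      obtain ⟨hne, -⟩ := hne
      obtain ⟨-, t, htu, htf⟩ := hnf
      rcases Sym2.mem_iff.1 htu with rfl | rfl
      · exact htf
      replace hef : G.lineGraph.Adj ⟨g, hg⟩ ⟨f, hf⟩ := hef
      rw [lineGraph_adj_iff_exists] at hef
      obtain ⟨-, r, hre, hrf⟩ := hef
      by_contra huf
      obtain ⟨s, rfl⟩ := Sym2.mem_iff_exists.1 ih
      obtain ⟨s', rfl⟩ := Sym2.mem_iff_exists.1 htf
      have hus : G.Adj u s := hg
      have hvs : G.Adj t s' := hf
      have hts : t ≠ s := by rintro rfl; exact hne rfl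
      rcases Sym2.mem_iff.1 hre with rfl | rfl
      · exact huf hrf
      · rcases Sym2.mem_iff.1 hrf with rfl | rfl
        · exact hts rfl
        · exact htri _ ⟨hus, hvs⟩
  have := key _ hreach
  simp [hux, huv.ne] at this

/-! ### Distances, diameters and universal pairs. -/

/-- A connected graph of diameter at least three has a disconnected cut. -/
theorem Connected.hasDisconnectedCut_of_two_lt_edist {u v : V} (hG : G.Connected)
    (h : 2 < G.edist u v) : G.HasDisconnectedCut := by
  obtain ⟨p, hp⟩ := hG.exists_walk_length_eq_dist u v
  have hd : 2 < G.dist u v := by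
    rw [← (hG u v).coe_dist_eq_edist] at h
    exact_mod_cast h
  have hadj : ∀ {x y}, G.Adj x y → G.dist u y ≤ G.dist u x + 1 := fun {x y} hxy ↦ by
    simpa [dist_eq_one_iff_adj.2 hxy] using hG.dist_triangle (u := u) (v := x) (w := y)
  -- A shortest walk meets every distance level, so levels 1 and 2 are nonempty.
  have hget : ∀ i ≤ p.length, G.dist u (p.getVert i) = i := by
    intro i hi
    refine le_antisymm ((dist_le (p.take i)).trans (by simp)) ?_
    have h1 := hG.dist_triangle (u := u) (v := p.getVert i) (w := v)
    have h2 := dist_le (p.drop i)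
    rw [Walk.drop_length] at h2
    omega
  refine ⟨{x | G.dist u x = 0}, {x | G.dist u x = 1}, {x | G.dist u x = 2}, {x | 2 < G.dist u x},
    ⟨u, by simp⟩, ⟨_, hget 1 (by omega)⟩, ⟨_, hget 2 (by omega)⟩, ⟨v, hd⟩,
    ?_, ?_, ?_, ?_, ?_, ?_, ?_, ?_, ?_⟩
  iterate 6
    rw [Set.disjoint_left]; intro x hx hy; simp only [Set.mem_ofPred_eq] at hx hy; omega
  · ext x; simp only [Set.mem_union, Set.mem_ofPred_eq, Set.mem_univ, iff_true]; omega
  all_goals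
    intro x hx y hy hxy
    have := hadj hxy
    simp only [Set.mem_ofPred_eq] at hx hy
    omega

/-- The common neighbours in the line graph of two disjoint edges are the edges joining them. If the
two edges share a vertex, one of the listed adjacencies is one of the edges themselves. -/
lemma two_lt_edist_lineGraph_iff {a b c d : V} (hab : G.Adj a b) (hcd : G.Adj c d) :
    2 < G.lineGraph.edist ⟨s(a, b), hab⟩ ⟨s(c, d), hcd⟩ ↔
      ¬ (G.Adj a c ∨ G.Adj a d ∨ G.Adj b c ∨ G.Adj b d) := by
  rw [two_lt_edist_iff]
  constructor
  · rintro ⟨hne, hnadj, hcom⟩ hj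
    obtain ⟨s, t, hst, hs, ht⟩ : ∃ s t, G.Adj s t ∧ s ∈ s(a, b) ∧ t ∈ s(c, d) := by
      rcases hj with h | h | h | h
      · exact ⟨a, c, h, by simp, by simp⟩
      · exact ⟨a, d, h, by simp, by simp⟩
      · exact ⟨b, c, h, by simp, by simp⟩
      · exact ⟨b, d, h, by simp, by simp⟩
    have hdisj : ∀ x, x ∈ s(a, b) → x ∉ s(c, d) := fun x h1 h2 ↦
      hnadj (lineGraph_adj_iff_exists.2 ⟨hne, x, h1, h2⟩)
    have : (⟨s(s, t), hst⟩ : G.edgeSet) ∈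
        G.lineGraph.commonNeighbors ⟨s(a, b), hab⟩ ⟨s(c, d), hcd⟩ := by
      rw [mem_commonNeighbors, lineGraph_adj_iff_exists, lineGraph_adj_iff_exists]
      refine ⟨⟨fun h ↦ ?_, s, hs, by simp⟩, fun h ↦ ?_, t, ht, by simp⟩
      · have h : s(a, b) = s(s, t) := congrArg Subtype.val h
        exact hdisj t (h ▸ Sym2.mem_mk_right s t) ht
      · have h : s(c, d) = s(s, t) := congrArg Subtype.val h
        exact hdisj s hs (h ▸ Sym2.mem_mk_left s t)
    rw [hcom] at this
    exact this
  · intro hj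
    have hdisj : ∀ x, x ∈ s(a, b) → x ∉ s(c, d) := by
      intro x hx hx'
      rcases Sym2.mem_iff.1 hx with rfl | rfl <;> rcases Sym2.mem_iff.1 hx' with rfl | rfl
      all_goals simp_all [G.adj_comm]
    refine ⟨fun h ↦ ?_, fun h ↦ ?_, ?_⟩
    · have h : s(a, b) = s(c, d) := congrArg Subtype.val h
      exact hdisj a (by simp) (h ▸ Sym2.mem_mk_left a b)
    · obtain ⟨-, x, hx, hx'⟩ := lineGraph_adj_iff_exists.1 h
      exact hdisj x hx hx'
    · rw [Set.eq_empty_iff_forall_notMem]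
      rintro ⟨e, he⟩ hmem
      rw [mem_commonNeighbors, lineGraph_adj_iff_exists, lineGraph_adj_iff_exists] at hmem
      obtain ⟨⟨-, s, hs, hse⟩, -, t, ht, hte⟩ := hmem
      have hst : s ≠ t := by rintro rfl; exact hdisj s hs ht
      obtain rfl := (Sym2.mem_and_mem_iff hst).1 ⟨hse, hte⟩
      rw [mem_edgeSet] at he
      rcases Sym2.mem_iff.1 hs with rfl | rfl <;> rcases Sym2.mem_iff.1 ht with rfl | rfl <;> tauto

theorem hasDisconnectedCut_lineGraph_iff (hG : G.lineGraph.Connected) :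
    G.lineGraph.HasDisconnectedCut ↔ ¬ G.EdgesJoined ∨ ∃ u v, G.IsCuttingEdge u v := by
  constructor
  · intro h
    by_cases hJ : G.EdgesJoined
    · exact .inr (hJ.exists_isCuttingEdge_of_hasDisconnectedCut h)
    · exact .inl hJ
  · rintro (h | ⟨u, v, h⟩)
    · simp only [EdgesJoined, not_forall] at h
      obtain ⟨a, b, c, d, hab, hcd, h⟩ := h
      exact hG.hasDisconnectedCut_of_two_lt_edist ((two_lt_edist_lineGraph_iff hab hcd).2 h)
    · exact h.hasDisconnectedCut

lemma edgesJoined_of_ediam_lineGraph_le (h : G.lineGraph.ediam ≤ 2) : G.EdgesJoined := by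
  intro a b c d hab hcd
  by_contra hj
  exact ((edist_le_ediam.trans h).trans_lt ((two_lt_edist_lineGraph_iff hab hcd).2 hj)).false

lemma EdgesJoined.isTwoPTwoFree (hG : G.EdgesJoined) : G.IsTwoPTwoFree := by
  rintro ⟨f⟩
  have h := hG (f (.inl 0)) (f (.inl 1)) (f (.inr 0)) (f (.inr 1))
  simp only [f.map_adj_iff] at h
  have h01 : (pathGraph 2).Adj 0 1 := by simp [pathGraph_adj]
  have := h h01 h01
  simp [SimpleGraph.sum] at this

lemma EdgesJoined.ediam_le_three (hG : G.EdgesJoined) (hdeg : ∀ u, ∃ v, G.Adj u v) :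
    G.ediam ≤ 3 := by
  refine ediam_le_of_edist_le fun u v ↦ ?_
  have bound : ∀ p : G.Walk u v, p.length ≤ 3 → G.edist u v ≤ 3 :=
    fun p hp ↦ (edist_le p).trans (by exact_mod_cast hp)
  obtain ⟨u', hu⟩ := hdeg u
  obtain ⟨v', hv⟩ := hdeg v
  rcases hG u u' v v' hu hv with h | h | h | h
  · exact bound (.cons h .nil) (by simp)
  · exact bound (.cons h (.cons hv.symm .nil)) (by simp)
  · exact bound (.cons hu (.cons h .nil)) (by simp)
  · exact bound (.cons hu (.cons h (.cons hv.symm .nil))) (by simp)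

/-- In a graph of diameter at most two, the cutting edges are the universal pairs of the
complement. -/
lemma isUniversalPair_compl_iff_isCuttingEdge (hd : G.ediam ≤ 2) {u v : V} :
    Gᶜ.IsUniversalPair u v ↔ G.IsCuttingEdge u v := by
  have hdist : ∀ x y, x = y ∨ G.Adj x y ∨ ∃ z, G.Adj x z ∧ G.Adj z y := by
    intro x y
    by_contra! hcon
    obtain ⟨h1, h2, h3⟩ := hcon
    refine ((edist_le_ediam.trans hd).trans_lt (two_lt_edist_iff.2 ⟨h1, h2, ?_⟩)).false
    rw [Set.eq_empty_iff_forall_notMem]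
    intro z hz
    rw [mem_commonNeighbors] at hz
    exact h3 z hz.1 hz.2.symm
  simp only [IsUniversalPair, IsDominatingSet, compl_adj, Set.mem_insert_iff,
    Set.mem_singleton_iff, not_or, exists_eq_or_imp, exists_eq_left]
  constructor
  · rintro ⟨huv, hdom, x, y, hxy, ⟨hxu, hxv⟩, ⟨hyu, hyv⟩, ⟨-, hux⟩, -, hvy⟩
    -- Domination in the complement says that no vertex is adjacent in `G` to both `u` and `v`.
    have htri : ∀ t, ¬ (G.Adj u t ∧ G.Adj v t) := by
      rintro t ⟨h1, h2⟩
      have := hdom t ⟨h1.ne', h2.ne'⟩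
      have := h1.symm
      have := h2.symm
      tauto
    have hadj : G.Adj u v := by
      rcases hdist u v with h | h | ⟨z, h1, h2⟩
      exacts [(huv h).elim, h, (htri z ⟨h1, h2.symm⟩).elim]
    -- A shortest path from `s` to `t` has length at most 2, and its first step avoids `r` because
    -- `r` is not adjacent to `t`.
    have nbr : ∀ {r s t}, t ≠ r → t ≠ s → ¬ G.Adj r t → ∃ z, G.Adj s z ∧ r ≠ z := by
      intro r s t hne' hne hnadj
      rcases hdist s t with h | h | ⟨z, h1, h2⟩
      · exact (hne h.symm).elim
      · exact ⟨t, h, hne'.symm⟩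
      · exact ⟨z, h1, by rintro rfl; exact hnadj h2⟩
    obtain ⟨x', hvx', hux'⟩ := nbr hxu hxv hux
    obtain ⟨y', huy', hvy'⟩ := nbr hyv hyu hvy
    refine ⟨hadj, htri, ⟨x', hvx', hux'⟩, ⟨y', huy', hvy'⟩, ?_⟩
    -- The first edge of a shortest path from `x'` to `y'` avoids `u` and `v`: a path through either
    -- would give them a common neighbour.
    rcases hdist x' y' with rfl | h | ⟨z, h1, h2⟩
    · exact (htri x' ⟨huy', hvx'⟩).elim
    · exact ⟨x', y', h, hux', hvx'.ne, huy'.ne, hvy'⟩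
    · refine ⟨x', z, h1, hux', hvx'.ne, ?_, ?_⟩
      · rintro rfl
        exact htri x' ⟨h1.symm, hvx'⟩
      · rintro rfl
        exact htri y' ⟨huy', h2⟩
  · rintro ⟨huv, htri, ⟨x, hvx, hux⟩, ⟨y, huy, hvy⟩, -⟩
    refine ⟨huv.ne, fun w hw ↦ ?_, x, y, ?_, ⟨hux.symm, hvx.ne'⟩, ⟨huy.ne', hvy.symm⟩,
      ⟨hux, fun h ↦ htri x ⟨h, hvx⟩⟩, hvy, fun h ↦ htri y ⟨huy, h⟩⟩
    · have := htri w
      simp only [G.adj_comm w]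
      tauto
    · rintro rfl
      exact htri x ⟨huy, hvx⟩

end DisconnectedCut

end SimpleGraph

namespace WordRAM

/-! ### First-order formulas and their compilation to nested loops. -/

section Formulas

/-- First-order formulas in the language of graphs. Variables are numbered by the depth of the
quantifier that binds them. -/
inductive Formula where
  | adj (i j : ℕ)
  | eq (i j : ℕ)
  | and (φ ψ : Formula)
  | not (φ : Formula)
  | ex (φ : Formula)

namespace Formula

/-- Truth of a formula under `d` quantifiers with the assignment `v` of vertices to variables. -/
def Holds {V : Type*} (G : SimpleGraph V) : ℕ → (ℕ → V) → Formula → Prop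
  | _, v, adj i j => G.Adj (v i) (v j)
  | _, v, eq i j => v i = v j
  | d, v, and φ ψ => φ.Holds G d v ∧ ψ.Holds G d v
  | d, v, not φ => ¬ φ.Holds G d v
  | d, v, ex φ => ∃ a, φ.Holds G (d + 1) (Function.update v d a)

/-- All free variables of the formula are smaller than `d`. -/
def Scoped : ℕ → Formula → Prop
  | d, adj i j => i < d ∧ j < d
  | d, eq i j => i < d ∧ j < d
  | d, and φ ψ => φ.Scoped d ∧ ψ.Scoped d
  | d, not φ => φ.Scoped d
  | d, ex φ => φ.Scoped (d + 1)

/-- The number of instructions of the code of a formula. -/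
def codeLength : Formula → ℕ
  | adj _ _ => 5
  | eq _ _ => 2
  | and φ ψ => φ.codeLength + ψ.codeLength
  | not φ => φ.codeLength + 1
  | ex φ => φ.codeLength + 5

/-- The code of a formula under `d` quantifiers, placed at line `s`: it continues behind its last
line if the formula holds, and at line `f` if not. Register `0` contains the number of vertices,
register `1` the number one, register `2` zero, and register `i + 4` the variable `i`. -/
def code : ℕ → ℕ → ℕ → Formula → Program
  | _, s, f, adj i j =>
    [.mul 3 (i + 4) 0, .add 3 3 (j + 4), .load 3 3, .jumpLt 2 3 (s + 5), .jumpLt 2 0 f]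
  | _, _, f, eq i j => [.jumpLt (i + 4) (j + 4) f, .jumpLt (j + 4) (i + 4) f]
  | d, s, f, and φ ψ => φ.code d s f ++ ψ.code d (s + φ.codeLength) f
  | d, s, f, not φ => φ.code d s (s + φ.codeLength + 1) ++ [.jumpLt 2 0 f]
  | d, s, f, ex φ =>
    .const (d + 4) 0 :: (φ.code (d + 1) (s + 1) (s + 1 + φ.codeLength + 1) ++
      [.jumpLt 2 0 (s + (φ.codeLength + 5)), .add (d + 4) (d + 4) 1, .jumpLt (d + 4) 0 (s + 1),
        .jumpLt 2 0 f])

/-- A bound on the running time of the code of a formula on graphs with `n` vertices. -/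
def cost (n : ℕ) : Formula → ℕ
  | adj _ _ => 5
  | eq _ _ => 2
  | and φ ψ => φ.cost n + ψ.cost n
  | not φ => φ.cost n + 1
  | ex φ => n * (φ.cost n + 2) + 2

/-- The quantifier depth of a formula. -/
def depth : Formula → ℕ
  | adj _ _ => 0
  | eq _ _ => 0
  | and φ ψ => max φ.depth ψ.depth
  | not φ => φ.depth
  | ex φ => φ.depth + 1

lemma length_code (φ : Formula) (d s f : ℕ) : (φ.code d s f).length = φ.codeLength := by
  induction φ generalizing d s f with
  | adj | eq => rfl
  | and φ ψ hφ hψ => simp [code, codeLength, hφ, hψ]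
  | not φ hφ => simp [code, codeLength, hφ]
  | ex φ hφ => simp [code, codeLength, hφ]

lemma cost_le (φ : Formula) {n : ℕ} (hn : 0 < n) : φ.cost n ≤ φ.codeLength * n ^ φ.depth := by
  induction φ with
  | adj | eq => simp [cost, codeLength, depth]
  | and φ ψ hφ hψ =>
    rw [cost, codeLength, depth, add_mul]
    exact add_le_add (hφ.trans (by gcongr; omega)) (hψ.trans (by gcongr; omega))
  | not φ hφ =>
    rw [cost, codeLength, depth, add_mul]
    exact add_le_add hφ (by rw [one_mul]; exact Nat.one_le_pow _ _ hn)
  | ex φ hφ =>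
    have h1 : 1 ≤ n ^ φ.depth := Nat.one_le_pow _ _ hn
    rw [cost, codeLength, depth, pow_succ]
    calc n * (φ.cost n + 2) + 2
        ≤ n * (φ.codeLength * n ^ φ.depth + 2 * n ^ φ.depth) + 2 * (n ^ φ.depth * n) := by
          gcongr
          · omega
          · nlinarith
      _ ≤ (φ.codeLength + 5) * (n ^ φ.depth * n) := by
          have : 0 ≤ n ^ φ.depth * n := Nat.zero_le _
          nlinarith

end Formula

end Formulas

/-! ### Correctness and running time of the compiled code. -/

section Execution

variable {P : Program} {w : ℕ}

/-- The instructions `l` stand in the program `P` from line `s` on. -/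
def CodeAt (P : Program) (s : ℕ) (l : Program) : Prop :=
  ∀ i < l.length, P[s + i]? = l[i]?

lemma codeAt_cons {s : ℕ} {i : Instr} {l : Program} :
    CodeAt P s (i :: l) ↔ P[s]? = some i ∧ CodeAt P (s + 1) l := by
  constructor
  · intro h
    refine ⟨by simpa using h 0 (by simp), fun j hj ↦ ?_⟩
    have := h (j + 1) (by simpa using hj)
    rw [show s + 1 + j = s + (j + 1) by omega, this, List.getElem?_cons_succ]
  · rintro ⟨h0, h⟩ (_ | j) hj
    · simpa using h0
    · rw [show s + (j + 1) = s + 1 + j by omega, h j (by simpa using hj), List.getElem?_cons_succ]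

lemma codeAt_append {s : ℕ} {l l' : Program} :
    CodeAt P s (l ++ l') ↔ CodeAt P s l ∧ CodeAt P (s + l.length) l' := by
  induction l generalizing s with
  | nil => simp [CodeAt]
  | cons i l ih =>
    rw [List.cons_append, codeAt_cons, codeAt_cons, ih, List.length_cons, and_assoc,
      show s + 1 + l.length = s + (l.length + 1) by omega]

lemma HaltsWithin.mono {c : Config} {t t' : ℕ} {b : Bool} (h : HaltsWithin P w c t b)
    (ht : t ≤ t') : HaltsWithin P w c t' b := by
  obtain ⟨k, rfl⟩ := Nat.exists_eq_add_of_le' ht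
  rw [HaltsWithin, Function.iterate_add_apply, h]
  exact Function.iterate_fixed rfl k

lemma HaltsWithin.of_exec {pc : ℕ} {reg mem : ℕ → ℕ} {i : Instr} {t : ℕ} {b : Bool}
    (hi : P[pc]? = some i) (h : HaltsWithin P w (exec w pc reg mem i) t b) :
    HaltsWithin P w (.running pc reg mem) (t + 1) b := by
  rw [HaltsWithin, Function.iterate_succ_apply, step, hi]
  exact h

variable {n : ℕ} {G : SimpleGraph (Fin n)}

/-- The registers hold the constants used by the code of formulas and the first `d` variables. -/
structure IsState (n d : ℕ) (v : ℕ → Fin n) (reg : ℕ → ℕ) : Prop where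
  size : reg 0 = n
  one : reg 1 = 1
  zero : reg 2 = 0
  var : ∀ i < d, reg (i + 4) = v i

lemma IsState.update_scratch {d : ℕ} {v : ℕ → Fin n} {reg : ℕ → ℕ} (h : IsState n d v reg)
    (a : ℕ) : IsState n d v (Function.update reg 3 a) where
  size := by simp [h.size]
  one := by simp [h.one]
  zero := by simp [h.zero]
  var i hi := by rw [Function.update_of_ne (by omega), h.var i hi]

lemma IsState.update_var {d : ℕ} {v : ℕ → Fin n} {reg : ℕ → ℕ} (h : IsState n d v reg)
    (a : ℕ) : IsState n d v (Function.update reg (d + 4) a) where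
  size := by rw [Function.update_of_ne (by omega), h.size]
  one := by rw [Function.update_of_ne (by omega), h.one]
  zero := by rw [Function.update_of_ne (by omega), h.zero]
  var i hi := by rw [Function.update_of_ne (by omega), h.var i hi]

lemma IsState.succ {d : ℕ} {v : ℕ → Fin n} {reg : ℕ → ℕ} (h : IsState n d v reg) {a : Fin n}
    (ha : reg (d + 4) = a) : IsState n (d + 1) (Function.update v d a) reg where
  size := h.size
  one := h.one
  zero := h.zero
  var i hi := by
    rcases Nat.lt_succ_iff_lt_or_eq.1 hi with hi | rfl
    · rw [Function.update_of_ne hi.ne, h.var i hi]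
    · rw [Function.update_self, ha]

lemma IsState.of_succ {d : ℕ} {v : ℕ → Fin n} {a : Fin n} {reg : ℕ → ℕ}
    (h : IsState n (d + 1) (Function.update v d a) reg) :
    IsState n d v reg ∧ reg (d + 4) = a where
  left :=
    { size := h.size
      one := h.one
      zero := h.zero
      var := fun i hi ↦ by rw [h.var i (by omega), Function.update_of_ne hi.ne] }
  right := by rw [h.var d (by omega), Function.update_self]

open Classical in
/-- The initial memory on the graph `G`. -/
noncomputable def adjMem (G : SimpleGraph (Fin n)) (a : ℕ) : ℕ :=
  if ∃ i j : Fin n, a = (i : ℕ) * n + (j : ℕ) ∧ G.Adj i j then 1 else 0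

open Classical in
-- Division with remainder by `n` recovers both indices from the address.
lemma adjMem_apply (i j : Fin n) :
    adjMem G ((i : ℕ) * n + (j : ℕ)) = if G.Adj i j then 1 else 0 := by
  have hn : 0 < n := i.pos
  have hdiv : ∀ i j : Fin n, ((i : ℕ) * n + j) / n = i := fun i j ↦ by
    rw [mul_comm, Nat.mul_add_div hn, Nat.div_eq_of_lt j.2, add_zero]
  have hmod : ∀ i j : Fin n, ((i : ℕ) * n + j) % n = j := fun i j ↦ by
    rw [Nat.mul_add_mod_self_right, Nat.mod_eq_of_lt j.2]
  refine if_congr ⟨?_, fun h ↦ ⟨i, j, rfl, h⟩⟩ rfl rfl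
  rintro ⟨i', j', h, hadj⟩
  have hi : i = i' := Fin.ext (by rw [← hdiv i j, h, hdiv])
  have hj : j = j' := Fin.ext (by rw [← hmod i j, h, hmod])
  rwa [hi, hj]

open Classical in
/-- The code of a formula evaluates the formula. -/
theorem haltsWithin_code (hn : 2 ≤ n) (hw : n ^ 2 ≤ 2 ^ w) (φ : Formula) {d s f : ℕ}
    {v : ℕ → Fin n} {reg : ℕ → ℕ} (hφ : φ.Scoped d) (hP : CodeAt P s (φ.code d s f))
    (hreg : IsState n d v reg) {t : ℕ} {b : Bool}
    (h : ∀ reg', IsState n d v reg' → HaltsWithin P w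
      (.running (if φ.Holds G d v then s + φ.codeLength else f) reg' (adjMem G)) t b) :
    HaltsWithin P w (.running s reg (adjMem G)) (t + φ.cost n) b := by
  -- Register 2 holds 0 and register 0 holds `n > 0`, so this jump is unconditional.
  have goto : ∀ {pc l t : ℕ} {reg : ℕ → ℕ} {d : ℕ} {v : ℕ → Fin n},
      P[pc]? = some (.jumpLt 2 0 l) → IsState n d v reg →
      HaltsWithin P w (.running l reg (adjMem G)) t b →
      HaltsWithin P w (.running pc reg (adjMem G)) (t + 1) b := by
    intro pc l t reg d v hpc hreg h
    refine .of_exec hpc ?_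
    rwa [exec, if_pos (by rw [hreg.zero, hreg.size]; omega)]
  -- The continuation `h` must accept every valid register state, since evaluation overwrites the
  -- scratch register and those of deeper variables.
  induction φ generalizing d s f v reg t with
  | adj i j =>
    simp only [Formula.code, codeAt_cons] at hP
    obtain ⟨h0, h1, h2, h3, h4, -⟩ := hP
    obtain ⟨hi, hj⟩ := hφ
    have hlt : (v i : ℕ) * n + v j < 2 ^ w := by
      refine lt_of_lt_of_le ?_ hw
      have := (v i).2
      have := (v j).2
      nlinarith
    have hstate := ((hreg.update_scratch (v i * n)).update_scratch
      (v i * n + v j)).update_scratch (if G.Adj (v i) (v j) then 1 else 0)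
    refine .of_exec h0 (.of_exec h1 (.of_exec h2 ?_))
    simp only [exec, Function.update_self, ne_eq, Nat.reduceEqDiff, not_false_eq_true,
      Function.update_of_ne, hreg.var i hi, hreg.var j hj, hreg.size]
    rw [Nat.mod_eq_of_lt (by omega), Nat.mod_eq_of_lt hlt, adjMem_apply]
    have h := h _ hstate
    rw [Formula.Holds] at h
    refine .of_exec h3 ?_
    rw [exec, Function.update_self, hstate.zero]
    by_cases hadj : G.Adj (v i) (v j)
    · rw [if_pos hadj] at h
      rw [if_pos (by rw [if_pos hadj]; exact zero_lt_one)]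
      exact h.mono (by omega)
    · rw [if_neg hadj] at h
      rw [if_neg (by rw [if_neg hadj]; exact lt_irrefl 0)]
      exact goto h4 hstate h
  | eq i j =>
    simp only [Formula.code, codeAt_cons] at hP
    obtain ⟨h0, h1, -⟩ := hP
    obtain ⟨hi, hj⟩ := hφ
    have h := h _ hreg
    rw [Formula.Holds] at h
    refine .of_exec h0 ?_
    rw [exec, hreg.var i hi, hreg.var j hj]
    by_cases hij : v i = v j
    · rw [if_pos hij] at h
      rw [hij, if_neg (lt_irrefl _)]
      refine .of_exec h1 ?_
      rw [exec, hreg.var i hi, hreg.var j hj, hij, if_neg (lt_irrefl _)]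
      exact h
    · rw [if_neg hij] at h
      rcases lt_or_gt_of_ne (Fin.val_ne_of_ne hij) with hlt | hlt
      · rw [if_pos hlt]
        exact h.mono (by omega)
      · rw [if_neg hlt.not_gt]
        refine .of_exec h1 ?_
        rw [exec, hreg.var i hi, hreg.var j hj, if_pos hlt]
        exact h
  | and φ ψ hφ' hψ' =>
    rw [Formula.code, codeAt_append, Formula.length_code] at hP
    have := hφ' hφ.1 hP.1 hreg (t := t + ψ.cost n) fun reg' hreg' ↦ by
      by_cases hh : φ.Holds G d v
      · rw [if_pos hh]
        refine hψ' hφ.2 hP.2 hreg' fun reg'' hreg'' ↦ ?_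
        simpa [Formula.Holds, hh, Formula.codeLength, add_assoc] using h reg'' hreg''
      · rw [if_neg hh]
        refine HaltsWithin.mono ?_ (Nat.le_add_right t _)
        simpa [Formula.Holds, hh] using h reg' hreg'
    exact this.mono (by rw [Formula.cost]; omega)
  | not φ hφ' =>
    rw [Formula.code, codeAt_append, Formula.length_code, codeAt_cons] at hP
    have := hφ' hφ hP.1 hreg (t := t + 1) fun reg' hreg' ↦ by
      by_cases hh : φ.Holds G d v
      · rw [if_pos hh]
        refine goto hP.2.1 hreg' ?_
        simpa [Formula.Holds, hh] using h reg' hreg'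
      · rw [if_neg hh]
        refine HaltsWithin.mono ?_ (Nat.le_add_right t 1)
        simpa [Formula.Holds, hh, Formula.codeLength, add_assoc] using h reg' hreg'
    exact this.mono (by rw [Formula.cost]; omega)
  | ex φ hφ' =>
    rw [Formula.code, codeAt_cons, codeAt_append, Formula.length_code] at hP
    simp only [codeAt_cons] at hP
    obtain ⟨h0, hbody, h1, h2, h3, h4, -⟩ := hP
    -- The counter reaches `n` itself; there is no overflow because `n < n ^ 2` for `n ≥ 2`.
    have hsucc : ∀ m ≤ n, m % 2 ^ w = m := fun m hm ↦ Nat.mod_eq_of_lt (by nlinarith)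
    -- One iteration: the two extra steps are the increment and the comparison. A witness leaves the
    -- loop by a single jump.
    have body : ∀ (a : Fin n) (reg : ℕ → ℕ) (t' : ℕ), t ≤ t' → IsState n d v reg →
        reg (d + 4) = a →
        (¬ φ.Holds G (d + 1) (Function.update v d a) → ∀ reg', IsState n d v reg' →
          reg' (d + 4) = a + 1 → HaltsWithin P w (.running
            (if (a : ℕ) + 1 < n then s + 1 else s + 1 + φ.codeLength + 1 + 1 + 1) reg' (adjMem G))
            t' b) →
        HaltsWithin P w (.running (s + 1) reg (adjMem G)) (t' + 2 + φ.cost n) b := by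
      intro a reg t' ht hreg ha hnext
      refine hφ' hφ hbody (hreg.succ ha) fun reg' hreg' ↦ ?_
      obtain ⟨hreg', ha'⟩ := hreg'.of_succ
      split_ifs with hh
      · refine (goto h1 hreg' (t := t) ?_).mono (by omega)
        have := h reg' hreg'
        rwa [if_pos ⟨a, hh⟩] at this
      · have hnext := hnext hh _ (hreg'.update_var (a + 1)) (by simp)
        have ha1 := hsucc (a + 1) a.2
        refine .of_exec h2 ?_
        rw [exec, ha', hreg'.one, ha1]
        refine .of_exec h3 ?_
        rw [exec, Function.update_self, (hreg'.update_var (a + 1)).size]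
        exact hnext
    -- Here `k + 1` values remain to be tried and all smaller ones have failed; the extra step is
    -- the final jump to `f`.
    have loop : ∀ k a : ℕ, a + (k + 1) = n → (∀ a' : Fin n, (a' : ℕ) < a →
        ¬ φ.Holds G (d + 1) (Function.update v d a')) →
        ∀ reg, IsState n d v reg → reg (d + 4) = a →
        HaltsWithin P w (.running (s + 1) reg (adjMem G))
          (t + 1 + (k + 1) * (φ.cost n + 2)) b := by
      intro k
      induction k with
      | zero =>
        intro a han hbelow reg hreg ha
        refine (body ⟨a, by omega⟩ reg (t + 1) (by omega) hreg ha
          fun hh reg' hreg' ha' ↦ ?_).mono (by omega)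
        rw [if_neg (by simp only; omega)]
        refine goto h4 hreg' ?_
        have := h reg' hreg'
        rwa [if_neg] at this
        rintro ⟨a', ha'⟩
        rcases Nat.lt_or_ge a' a with hlt | hge
        · exact hbelow a' hlt ha'
        · have haa : a' = ⟨a, by omega⟩ := Fin.ext (by have := a'.2; simp only; omega)
          exact hh (haa ▸ ha')
      | succ k ih =>
        intro a han hbelow reg hreg ha
        refine (body ⟨a, by omega⟩ reg (t + 1 + (k + 1) * (φ.cost n + 2)) (by omega) hreg ha
          fun hh reg' hreg' ha' ↦ ?_).mono (by rw [add_mul (k + 1)]; omega)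
        rw [if_pos (by simp only; omega)]
        refine ih (a + 1) (by omega) (fun a' ha' ↦ ?_) reg' hreg' ha'
        rcases Nat.lt_or_ge a' a with hlt | hge
        · exact hbelow a' hlt
        · have haa : a' = ⟨a, by omega⟩ := Fin.ext (by simp only; omega)
          exact haa ▸ hh
    refine (HaltsWithin.of_exec (t := t + 1 + n * (φ.cost n + 2)) h0 ?_).mono
      (by rw [Formula.cost]; omega)
    have := loop (n - 1) 0 (by omega) (by simp) _ (hreg.update_var 0) (by simp)
    rw [Nat.sub_add_cancel (by omega)] at this
    simpa [exec] using this

/-- A graph property given by a first-order sentence of quantifier depth `k` is decided in time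
`O(n ^ k)`. -/
theorem exists_program_of_formula (φ : Formula) (hφ : φ.Scoped 0) :
    ∃ (P : Program) (C : ℕ), ∀ (n : ℕ) (G : SimpleGraph (Fin n)) (v : ℕ → Fin n), 2 ≤ n →
      ∀ w : ℕ, n ^ 2 ≤ 2 ^ w → ∃ answer : Bool,
        HaltsWithin P w (input G) (C * n ^ φ.depth) answer ∧
          (answer = true ↔ φ.Holds G 0 v) := by
  classical
  refine ⟨.const 1 1 :: (φ.code 0 1 (1 + φ.codeLength + 1) ++ [.halt true, .halt false]),
    φ.codeLength + 2, fun n G v hn w hw ↦ ⟨decide (φ.Holds G 0 v), ?_, by simp⟩⟩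
  set P : Program := .const 1 1 :: (φ.code 0 1 (1 + φ.codeLength + 1) ++ [.halt true, .halt false])
    with hP
  have hcode : CodeAt P 0 P := fun i _ ↦ by rw [zero_add]
  nth_rw 2 [hP] at hcode
  rw [codeAt_cons, codeAt_append, Formula.length_code, codeAt_cons, codeAt_cons] at hcode
  obtain ⟨h0, hφP, htrue, hfalse, -⟩ := hcode
  have hpow : 1 % 2 ^ w = 1 := Nat.mod_eq_of_lt (by nlinarith)
  have hrun : HaltsWithin P w (input G) (1 + φ.cost n + 1) (decide (φ.Holds G 0 v)) := by
    refine .of_exec h0 ?_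
    rw [exec, hpow]
    refine haltsWithin_code (v := v) hn hw φ hφ hφP ⟨by simp, by simp, by simp, by simp⟩
      fun reg' hreg' ↦ ?_
    by_cases hh : φ.Holds G 0 v
    · rw [if_pos hh, decide_eq_true hh]
      exact .of_exec (t := 0) htrue rfl
    · rw [if_neg hh, decide_eq_false hh]
      exact .of_exec (t := 0) hfalse rfl
  refine hrun.mono ?_
  have h1 := φ.cost_le (n := n) (by omega)
  have h2 : 1 ≤ n ^ φ.depth := Nat.one_le_pow _ _ (by omega)
  nlinarith

end Execution

end WordRAM

/-! ### The sentences for the criterion, and the theorem. -/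

namespace WordRAM

/-- The sentence saying that some two edges are neither adjacent nor joined by an edge. -/
def notJoinedFormula : Formula :=
  .ex (.ex (.ex (.ex (.and (.adj 0 1) (.and (.adj 2 3) (.and (.not (.adj 0 2))
    (.and (.not (.adj 0 3)) (.and (.not (.adj 1 2)) (.not (.adj 1 3))))))))))

/-- The sentence saying that there is a cutting edge. -/
def cuttingEdgeFormula : Formula :=
  .ex (.ex (.and (.adj 0 1) (.and (.not (.ex (.and (.adj 0 2) (.adj 1 2))))
    (.and (.ex (.and (.adj 1 2) (.not (.eq 0 2)))) (.and (.ex (.and (.adj 0 2) (.not (.eq 1 2))))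
      (.ex (.ex (.and (.adj 2 3) (.and (.not (.eq 0 2)) (.and (.not (.eq 1 2))
        (.and (.not (.eq 0 3)) (.not (.eq 1 3)))))))))))))

/-- The sentence saying that a connected line graph has a disconnected cut. -/
def lineGraphCutFormula : Formula :=
  .not (.and (.not notJoinedFormula) (.not cuttingEdgeFormula))

variable {V : Type*} {G : SimpleGraph V}

lemma holds_notJoinedFormula (v : ℕ → V) : notJoinedFormula.Holds G 0 v ↔ ¬ G.EdgesJoined := by
  simp [notJoinedFormula, Formula.Holds, Function.update, SimpleGraph.EdgesJoined]

lemma holds_cuttingEdgeFormula (v : ℕ → V) :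
    cuttingEdgeFormula.Holds G 0 v ↔ ∃ a b, G.IsCuttingEdge a b := by
  simp [cuttingEdgeFormula, Formula.Holds, Function.update, SimpleGraph.IsCuttingEdge]

lemma holds_lineGraphCutFormula (hG : G.lineGraph.Connected) (v : ℕ → V) :
    lineGraphCutFormula.Holds G 0 v ↔ G.lineGraph.HasDisconnectedCut := by
  rw [SimpleGraph.hasDisconnectedCut_lineGraph_iff hG, ← holds_notJoinedFormula v,
    ← holds_cuttingEdgeFormula v, lineGraphCutFormula, Formula.Holds, Formula.Holds,
    Formula.Holds, Formula.Holds]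
  tauto

end WordRAM

theorem mainTheorem4 :
    (∃ (P : WordRAM.Program) (C k : ℕ), ∀ (n : ℕ) (G : SimpleGraph (Fin n)),
      G.lineGraph.Connected → ∀ w : ℕ, n ^ k ≤ 2 ^ w →
        ∃ answer : Bool, WordRAM.HaltsWithin P w (WordRAM.input G) (C * n ^ 4) answer ∧
          (answer = true ↔ G.lineGraph.HasDisconnectedCut)) ∧
    (∀ (V : Type*) [Finite V] (G : SimpleGraph V), G.lineGraph.ediam = 2 →
      G.IsTwoPTwoFree ∧
      ((∀ u, ∃ v, G.Adj u v) → G.ediam ≤ 3) ∧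
      (G.ediam = 2 → (G.lineGraph.HasDisconnectedCut ↔ ∃ u v, Gᶜ.IsUniversalPair u v)) ∧
      ((∀ e, ¬ G.lineGraph.HasDisconnectedNeighborhood e) → G.ediam = 1 ∨ G.ediam = 3 →
        ¬ G.lineGraph.HasDisconnectedCut)) := by
  constructor
  · obtain ⟨P, C, hP⟩ := WordRAM.exists_program_of_formula WordRAM.lineGraphCutFormula
      (by simp [WordRAM.lineGraphCutFormula, WordRAM.notJoinedFormula, WordRAM.cuttingEdgeFormula,
        WordRAM.Formula.Scoped])
    -- The exponent 4 is the quantifier depth of the sentence; `k = 2` lets a word hold every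
    -- address of the adjacency matrix.
    refine ⟨P, C, 2, fun n G hG w hw ↦ ?_⟩
    -- A connected line graph is nonempty, so `G` has an edge. Its end `a` also serves as an
    -- arbitrary value for the assignment, as a sentence has no free variables.
    obtain ⟨⟨⟨a, b⟩, hab⟩⟩ := hG.nonempty
    have hn : 2 ≤ n := by
      have hne : (a : ℕ) ≠ b := Fin.val_ne_of_ne (SimpleGraph.Adj.ne (G := G) hab)
      omega
    obtain ⟨answer, hrun, hans⟩ := hP n G (fun _ ↦ a) hn w hw
    exact ⟨answer, hrun, hans.trans (WordRAM.holds_lineGraphCutFormula hG _)⟩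
  · intro V _ G hd
    have hJ := SimpleGraph.edgesJoined_of_ediam_lineGraph_le hd.le
    refine ⟨hJ.isTwoPTwoFree, hJ.ediam_le_three, fun hG ↦ ?_, fun hnbr _ hcut ↦ ?_⟩
    · simp only [SimpleGraph.isUniversalPair_compl_iff_isCuttingEdge hG.le]
      exact ⟨hJ.exists_isCuttingEdge_of_hasDisconnectedCut, fun ⟨_, _, h⟩ ↦ h.hasDisconnectedCut⟩
    · obtain ⟨u, v, h⟩ := hJ.exists_isCuttingEdge_of_hasDisconnectedCut hcut
      exact hnbr _ h.hasDisconnectedNeighborhood
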